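/- Let $n\ge 1$ and let $(W,S)$ be a finite Coxeter system of type $A_n$ with $S=\{s_1,\dots,s_n\}$ numbered along the Coxeter diagram, and let $\ell$ be its length function. For $0\le j\le n$ put $$x_j=\sum_{w\in X_j} w\in\mathbb{Q}W,\qquad X_j=\{w\in W:\ \ell(ws_i)>\ell(w)\text{ for all }1\le i\le j\},$$ and let $\mathfrak{E}(W)=\mathbb{Q}[x_{n-1}]$ be the smallest unital $\mathbb{Q}$-subalgebra of the group algebra $\mathbb{Q}W$ containing $x_{n-1}$. For $k\ge 0$ let $x^{\underline{k}}=\prod_{i=0}^{k-1}(x-i)$ be the $k$-th falling power. Then: 1. There is an isomorphism of $\mathbb{Q}$-algebras $\mathfrak{E}(W)\cong\mathbb{Q}[x]/(x^{\underline{n+1}}-x^{\underline{n}})$ sending $x_{n-1}$ to the class of $x$. 2. $x_{n-k}=x_{n-1}^{\underline{k}}$ for $0\le k\le n$. 3. Both $x_0,x_1,\dots,x_n$ and $x_{n-1}^0,x_{n-1}^1,\dots,x_{n-1}^n$ are $\mathbb{Q}$-bases of $\mathfrak{E}(W)$, and they are related by the base change formulas $$x_{n-k}=\sum_{m=0}^k(-1)^{k-m}\genfrac{[}{]}{0pt}{}{k}{m}x_{n-1}^m\quad\text{and}\quad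 x_{n-1}^k=\sum_{m=0}^k\genfrac{\{}{\}}{0pt}{}{k}{m}x_{n-m}\qquad(0\le k\le n),$$ where $\genfrac{[}{]}{0pt}{}{k}{m}$ and $\genfrac{\{}{\}}{0pt}{}{k}{m}$ are the (unsigned) Stirling numbers of the first kind and the Stirling numbers of the second kind. -/

import Mathlib

open scoped Polynomial

noncomputable section

namespace CoxeterDescent

variable {B : Type*} {M : CoxeterMatrix B} {W : Type*} [Group W]

/-- The distinguished transversal `X_J = {w ∈ W : ℓ(ws) > ℓ(w) for all s ∈ J}` of the left cosets of
the parabolic subgroup `W_J`. A set `J` of generators is given by the set of their indices. -/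
def transversal (cs : CoxeterSystem M W) (J : Set B) : Set W :=
  {w | ∀ i ∈ J, cs.length w < cs.length (w * cs.simple i)}

open scoped Classical in
/-- The standard basis element `x_J = ∑_{w ∈ X_J} w` of the descent algebra, as an element of the
rational group algebra `ℚ W`. -/
def xElt [Fintype W] (cs : CoxeterSystem M W) (J : Set B) : MonoidAlgebra ℚ W :=
  ∑ w : W with w ∈ transversal cs J, MonoidAlgebra.of ℚ W w

/-- The algebra `𝔈(W, x_J) = ℚ[x_J]`: the smallest (unital) `ℚ`-subalgebra of `ℚ W`
containing `x_J`. -/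
def nativeAlgebra [Fintype W] (cs : CoxeterSystem M W) (J : Set B) :
    Subalgebra ℚ (MonoidAlgebra ℚ W) :=
  Algebra.adjoin ℚ {xElt cs J}

/-- The left-connected set `{s₁, …, s_j}` of generators. The generators `s₁, …, s_n` have the
indices `0, …, n - 1` in `Fin n`. -/
def leftConnected (n j : ℕ) : Set (Fin n) := {i | (i : ℕ) < j}

/-- In type `A_n`: the element `x_j = x_{{s₁, …, s_j}}`. -/
def xA {n : ℕ} [Fintype W] (cs : CoxeterSystem (CoxeterMatrix.A n) W) (j : ℕ) :
    MonoidAlgebra ℚ W :=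
  xElt cs (leftConnected n j)

/-- In type `A_n`: the algebra `𝔈(W) = ℚ[x_{n-1}]`. -/
def algA {n : ℕ} [Fintype W] (cs : CoxeterSystem (CoxeterMatrix.A n) W) :
    Subalgebra ℚ (MonoidAlgebra ℚ W) :=
  nativeAlgebra cs (leftConnected n (n - 1))

theorem xA_mem_algA {n : ℕ} [Fintype W] (cs : CoxeterSystem (CoxeterMatrix.A n) W) :
    xA cs (n - 1) ∈ algA cs :=
  Algebra.self_mem_adjoin_singleton ℚ _

/-- The ideal `(x^{\underline{n+1}} - x^{\underline{n}})` of `ℚ[x]`; `descPochhammer ℚ k` is the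
falling power `x^{\underline{k}} = x (x - 1) ⋯ (x - k + 1)`. -/
def fallingIdeal (n : ℕ) : Ideal ℚ[X] :=
  Ideal.span {descPochhammer ℚ (n + 1) - descPochhammer ℚ n}

end CoxeterDescent

end

/-! A Coxeter group of type `A_n` is the symmetric group on the points `0, …, n`, with length the
number of inversions. Write a permutation as the word of its values. Then `X_m` consists of the
words whose first `m + 1` letters increase, and `x_{n-1}` is the sum of the permutations `insertLast
i`.

Right multiplication by the inverse of `insertLast i` takes the last letter of a word and reinserts
it at position `i`. Counting the `i` that leave the first `m + 1` letters increasing gives `x_m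
x_{n-1} = x_{m-1} + (n - m) x_m` (`xA_mul_xA_pred`), where `x_{-1}` is read as `x_0`. Starting from
`x_n = 1`, this recurrence produces the falling powers of `x_{n-1}`. At `m = 0` it produces the
relation between the falling powers of orders `n + 1` and `n`.

The `x_j` are independent by a triangularity argument (`linearIndependent_xA`), so there is no
relation of smaller degree. The base changes are those between powers and falling powers of a
variable. -/

noncomputable section

namespace CoxeterDescent

/-! ### The Coxeter group of type `A_n` as a symmetric group -/

section PermutationRepresentation

open Equiv

variable {n : ℕ} {W : Type*} [Group W] (cs : CoxeterSystem (CoxeterMatrix.A n) W)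

theorem isLiftable_swap (n : ℕ) :
    (CoxeterMatrix.A n).IsLiftable fun i : Fin n ↦ swap i.castSucc i.succ := by
  have key (i j : Fin n) (h : (i : ℕ) + 1 = j) :
      (swap i.castSucc i.succ * swap j.castSucc j.succ) ^ 3 = 1 := by
    have hji : j.castSucc = i.succ := by ext; simp [h]
    have h3 : (swap i.succ i.castSucc * swap i.succ j.succ).IsThreeCycle :=
      Perm.isThreeCycle_swap_mul_swap_same (by simp [Fin.ext_iff])
        (by simp [Fin.ext_iff]; omega) (by simp [Fin.ext_iff]; omega)
    rw [hji, swap_comm i.castSucc, ← h3.orderOf, pow_orderOf_eq_one]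
  intro i j
  change _ ^ (if i = j then 1 else if (j : ℕ) + 1 = i ∨ (i : ℕ) + 1 = j then 3 else 2) = 1
  split_ifs with h1 h2
  · simp [h1]
  · rcases h2 with h2 | h2
    · rw [← inv_inj, ← inv_pow, mul_inv_rev, swap_inv, swap_inv, key j i h2, inv_one]
    · exact key i j h2
  · have hd : Perm.Disjoint (swap i.castSucc i.succ) (swap j.castSucc j.succ) := by
      rw [Perm.disjoint_iff_disjoint_support, Perm.support_swap (by simp [Fin.ext_iff]),
        Perm.support_swap (by simp [Fin.ext_iff])]
      simp only [Finset.disjoint_insert_left, Finset.mem_insert, Finset.mem_singleton, Fin.ext_iff,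
        Finset.disjoint_singleton_left, Fin.val_castSucc, Fin.val_succ] at *
      omega
    rw [hd.commute.mul_pow]
    simp [pow_two]

/-- The homomorphism from a Coxeter group of type `A_n` to the symmetric group on `n + 1` points
which maps the `i`-th generator to the `i`-th adjacent transposition. -/
def toPerm : W →* Perm (Fin (n + 1)) := cs.lift ⟨_, isLiftable_swap n⟩

@[simp]
theorem toPerm_simple (i : Fin n) : toPerm cs (cs.simple i) = swap i.castSucc i.succ :=
  cs.lift_apply_simple (isLiftable_swap n) i

theorem toPerm_surjective : Function.Surjective (toPerm cs) := by
  rw [← MonoidHom.mrange_eq_top, eq_top_iff, ← Perm.mclosure_swap_castSucc_succ n,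
    Submonoid.closure_le]
  rintro _ ⟨i, rfl⟩
  exact ⟨cs.simple i, toPerm_simple cs i⟩

/-! ### Coset normal forms and faithfulness of the permutation representation -/

/-- The generators of a Coxeter group of type `A_n`, indexed by the natural numbers, with value `1`
at the indices out of range. -/
def simpleNat (i : ℕ) : W := if h : i < n then cs.simple ⟨i, h⟩ else 1

theorem simpleNat_mul_self (i : ℕ) : simpleNat cs i * simpleNat cs i = 1 := by
  unfold simpleNat; split_ifs <;> simp

theorem simpleNat_commute {i j : ℕ} (h : i + 1 < j) :
    Commute (simpleNat cs i) (simpleNat cs j) := by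
  unfold simpleNat
  split_ifs with hi hj <;> try simp
  have := cs.simple_mul_simple_pow ⟨i, hi⟩ ⟨j, hj⟩
  have hM : CoxeterMatrix.A n ⟨i, hi⟩ ⟨j, hj⟩ = 2 := by
    change (if _ then 1 else if _ then 3 else 2) = 2
    rw [if_neg (by simp only [Fin.ext_iff]; omega), if_neg (by simp only; omega)]
  rw [hM, pow_two, mul_eq_one_iff_eq_inv, mul_inv_rev, cs.inv_simple, cs.inv_simple] at this
  exact this

theorem simpleNat_braid {i : ℕ} (h : i + 1 < n) :
    simpleNat cs (i + 1) * simpleNat cs i * simpleNat cs (i + 1) =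
      simpleNat cs i * simpleNat cs (i + 1) * simpleNat cs i := by
  have hi : i < n := by omega
  have := cs.simple_mul_simple_pow ⟨i + 1, h⟩ ⟨i, hi⟩
  have hM : CoxeterMatrix.A n ⟨i + 1, h⟩ ⟨i, hi⟩ = 3 := by
    change (if _ then 1 else if _ then 3 else 2) = 3
    rw [if_neg (by simp only [Fin.ext_iff]; omega), if_pos (by simp)]
  rw [hM, pow_succ, pow_two, ← mul_assoc, ← mul_assoc, mul_assoc _ (cs.simple ⟨i, hi⟩),
    mul_assoc, mul_eq_one_iff_eq_inv] at this
  simp only [simpleNat, h, hi, dif_pos, mul_inv_rev, cs.inv_simple] at *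
  rw [this, mul_assoc]

/-- The product `s_{a+l-1} ⋯ s_{a+1} s_a`. -/
def descendingProd : ℕ → ℕ → W
  | _, 0 => 1
  | a, l + 1 => descendingProd (a + 1) l * simpleNat cs a

theorem descendingProd_commute {a j : ℕ} (l : ℕ) (h : j + 1 < a) :
    Commute (descendingProd cs a l) (simpleNat cs j) := by
  induction l generalizing a with
  | zero => exact Commute.one_left _
  | succ l ih => exact (ih (by omega)).mul_left (simpleNat_commute cs h).symm

/-- The letter commutes past `s_a, …, s_{a+t-1}`, drops its index by one in a braid move with
`s_{a+t+1} s_{a+t}`, and commutes past the rest. The bound `hn` keeps all indices in range, since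
the braid relation fails where `simpleNat` defaults to `1`. -/
theorem descendingProd_mul_simpleNat {a t l : ℕ} (h : t + 1 < l) (hn : a + l ≤ n) :
    descendingProd cs a l * simpleNat cs (a + t + 1) =
      simpleNat cs (a + t) * descendingProd cs a l := by
  induction t generalizing a l with
  | zero =>
    obtain ⟨l, rfl⟩ := Nat.exists_eq_add_of_le' h
    change descendingProd cs (a + 2) l * simpleNat cs (a + 1) * simpleNat cs a *
      simpleNat cs (a + 1) = simpleNat cs a * (descendingProd cs (a + 2) l *
        simpleNat cs (a + 1) * simpleNat cs a)
    have h1 := simpleNat_braid cs (i := a) (by omega)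
    have h2 := (descendingProd_commute cs (a := a + 2) (j := a) l (by omega)).eq
    calc _ = descendingProd cs (a + 2) l *
          (simpleNat cs (a + 1) * simpleNat cs a * simpleNat cs (a + 1)) := by
          simp only [mul_assoc]
      _ = descendingProd cs (a + 2) l * simpleNat cs a *
          (simpleNat cs (a + 1) * simpleNat cs a) := by rw [h1]; simp only [mul_assoc]
      _ = _ := by rw [h2]; simp only [mul_assoc]
  | succ t ih =>
    obtain ⟨l, rfl⟩ := Nat.exists_eq_add_of_le' (show 1 ≤ l by omega)
    have h1 := ih (a := a + 1) (l := l) (by omega) (by omega)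
    rw [show a + 1 + t + 1 = a + (t + 1) + 1 by ring, show a + 1 + t = a + (t + 1) by ring] at h1
    rw [descendingProd, mul_assoc, (simpleNat_commute cs (by omega)).eq, ← mul_assoc, h1, mul_assoc]

/-- The parabolic subgroup generated by the first `m` generators. -/
def initialParabolic (m : ℕ) : Subgroup W := Subgroup.closure {w | ∃ i < m, simpleNat cs i = w}

theorem simpleNat_mem_initialParabolic {i m : ℕ} (h : i < m) :
    simpleNat cs i ∈ initialParabolic cs m :=
  Subgroup.subset_closure ⟨i, h, rfl⟩

/-- The descending products ending at `s_m` represent the cosets of one initial parabolic in the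
next. It suffices that these cosets are permuted by right multiplication by generators: `s_j` is
absorbed into `u` for `j < a - 1` or `j > a`, lengthens the product for `j = a - 1`, and shortens it
for `j = a`. -/
theorem exists_eq_mul_descendingProd {m : ℕ} (hm : m + 1 ≤ n) {w : W}
    (hw : w ∈ initialParabolic cs (m + 1)) :
    ∃ u ∈ initialParabolic cs m, ∃ a l, a + l = m + 1 ∧ w = u * descendingProd cs a l := by
  have step (x : W) (j : ℕ) (hj : j < m + 1)
      (hx : ∃ u ∈ initialParabolic cs m, ∃ a l, a + l = m + 1 ∧ x = u * descendingProd cs a l) :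
      ∃ u ∈ initialParabolic cs m, ∃ a l, a + l = m + 1 ∧
        x * simpleNat cs j = u * descendingProd cs a l := by
    obtain ⟨u, hu, a, l, hal, rfl⟩ := hx
    rcases lt_trichotomy j a with h | rfl | h
    · rcases Nat.lt_or_ge (j + 1) a with h' | h'
      · refine ⟨u * simpleNat cs j, mul_mem hu (simpleNat_mem_initialParabolic cs (by omega)),
          a, l, hal, ?_⟩
        rw [mul_assoc, (descendingProd_commute cs l h').eq, mul_assoc]
      · obtain rfl : a = j + 1 := by omega
        exact ⟨u, hu, j, l + 1, by omega, by rw [mul_assoc, descendingProd]⟩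
    · obtain ⟨l, rfl⟩ := Nat.exists_eq_add_of_le' (show 1 ≤ l by omega)
      refine ⟨u, hu, j + 1, l, by omega, ?_⟩
      rw [descendingProd, mul_assoc, mul_assoc, simpleNat_mul_self, mul_one]
    · obtain ⟨t, rfl⟩ := Nat.exists_eq_add_of_le (show a + 1 ≤ j by omega)
      refine ⟨u * simpleNat cs (a + t),
        mul_mem hu (simpleNat_mem_initialParabolic cs (by omega)), a, l, hal, ?_⟩
      rw [mul_assoc, show a + 1 + t = a + t + 1 by ring,
        descendingProd_mul_simpleNat cs (by omega) (by omega), mul_assoc]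
  refine Subgroup.closure_induction_right
    (p := fun x _ ↦ ∃ u ∈ initialParabolic cs m, ∃ a l, a + l = m + 1 ∧
      x = u * descendingProd cs a l) ⟨1, one_mem _, m + 1, 0, rfl, by simp [descendingProd]⟩
    ?_ ?_ hw
  · rintro x - _ ⟨j, hj, rfl⟩ hx
    exact step x j hj hx
  · rintro x - _ ⟨j, hj, rfl⟩ hx
    rw [inv_eq_of_mul_eq_one_right (simpleNat_mul_self cs j)]
    exact step x j hj hx

theorem toPerm_apply_of_mem_initialParabolic {m : ℕ} {w : W} (hw : w ∈ initialParabolic cs m)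
    {p : Fin (n + 1)} (hp : m < p) : toPerm cs w p = p := by
  have : initialParabolic cs m ≤
      (MulAction.stabilizer (Perm (Fin (n + 1))) p).comap (toPerm cs) := by
    refine (Subgroup.closure_le _).2 ?_
    rintro _ ⟨i, hi, rfl⟩
    simp only [Subgroup.coe_comap, Set.mem_preimage, SetLike.mem_coe, MulAction.mem_stabilizer_iff,
      Perm.smul_def]
    unfold simpleNat
    split_ifs
    · rw [toPerm_simple, swap_apply_of_ne_of_ne] <;> simp only [ne_eq, Fin.ext_iff] <;> simp <;>
        omega
    · simp
  exact this hw

theorem toPerm_descendingProd {a l : ℕ} (h : a + l ≤ n) :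
    toPerm cs (descendingProd cs a l) ⟨a, by omega⟩ = ⟨a + l, by omega⟩ := by
  induction l generalizing a with
  | zero => simp [descendingProd]
  | succ l ih =>
    have ha : a < n := by omega
    rw [descendingProd, map_mul, Perm.mul_apply, simpleNat, dif_pos ha, toPerm_simple]
    have h1 : swap (Fin.castSucc (⟨a, ha⟩ : Fin n)) (Fin.succ ⟨a, ha⟩) ⟨a, by omega⟩ =
        ⟨a + 1, by omega⟩ := swap_apply_left _ _
    rw [h1, ih (by omega)]
    ext
    simp only
    omega

/-- The coset representative sends `a` to `m + 1`, a point fixed by `u`. A trivial image therefore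
forces `a = m + 1`, and the element already lies in the smaller parabolic. -/
theorem eq_one_of_mem_initialParabolic {m : ℕ} (hm : m ≤ n) {w : W}
    (hw : w ∈ initialParabolic cs m) (h : toPerm cs w = 1) : w = 1 := by
  induction m generalizing w with
  | zero => simpa [initialParabolic] using hw
  | succ m ih =>
    obtain ⟨u, hu, a, l, hal, rfl⟩ := exists_eq_mul_descendingProd cs hm hw
    have h1 : toPerm cs (u * descendingProd cs a l) ⟨a, by omega⟩ = ⟨a + l, by omega⟩ := by
      rw [map_mul, Perm.mul_apply, toPerm_descendingProd cs (by omega)]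
      exact toPerm_apply_of_mem_initialParabolic cs hu (by simp only; omega)
    rw [h, Perm.one_apply, Fin.mk.injEq] at h1
    obtain rfl : l = 0 := by omega
    rw [descendingProd, mul_one] at h ⊢
    exact ih (by omega) hu h

theorem toPerm_injective : Function.Injective (toPerm cs) := by
  refine (injective_iff_map_eq_one _).2 fun w hw ↦ ?_
  refine eq_one_of_mem_initialParabolic cs le_rfl ?_ hw
  suffices ⊤ ≤ initialParabolic cs n from this (Subgroup.mem_top w)
  rw [← cs.subgroup_closure_range_simple, Subgroup.closure_le]
  rintro _ ⟨i, rfl⟩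
  exact Subgroup.subset_closure ⟨i, i.2, by simp [simpleNat]⟩

/-- A Coxeter group of type `A_n` is isomorphic to the symmetric group on `n + 1` points. -/
def permEquiv : W ≃* Perm (Fin (n + 1)) :=
  MulEquiv.ofBijective (toPerm cs) ⟨toPerm_injective cs, toPerm_surjective cs⟩

@[simp]
theorem permEquiv_simple (i : Fin n) : permEquiv cs (cs.simple i) = swap i.castSucc i.succ :=
  toPerm_simple cs i

/-! ### Length as inversion number, and membership in `X_m` -/

/-- The number of inversions of a permutation. -/
def inversionCount (σ : Perm (Fin (n + 1))) : ℕ :=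
  Finset.card {p : Fin (n + 1) × Fin (n + 1) | p.1 < p.2 ∧ σ p.2 < σ p.1}

theorem inversionCount_one : inversionCount (1 : Perm (Fin (n + 1))) = 0 := by
  rw [inversionCount, Finset.card_eq_zero, Finset.filter_eq_empty_iff]
  exact fun p _ h ↦ lt_asymm h.1 h.2

/-- An adjacent transposition of positions preserves the order within every increasing pair except
the swapped one. It thus matches the old inversions with the new ones, and the swapped pair is the
one extra inversion. -/
theorem inversionCount_mul_swap (σ : Perm (Fin (n + 1))) (i : Fin n)
    (h : σ i.castSucc < σ i.succ) :
    inversionCount (σ * swap i.castSucc i.succ) = inversionCount σ + 1 := by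
  have hlt : ∀ {a b : Fin (n + 1)}, a < b → (a, b) ≠ (i.castSucc, i.succ) →
      swap i.castSucc i.succ a < swap i.castSucc i.succ b := by
    intro a b hab hne
    simp only [ne_eq, Prod.mk.injEq, Fin.ext_iff, swap_apply_def, Fin.lt_def] at *
    split_ifs <;> simp at * <;> omega
  have hmem : (i.castSucc, i.succ) ∉
      ({p : Fin (n + 1) × Fin (n + 1) | p.1 < p.2 ∧ σ p.2 < σ p.1} : Finset _) := by
    simp [h.le]
  rw [inversionCount, inversionCount, ← Finset.card_insert_of_notMem hmem]
  refine Finset.card_nbij'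
    (fun p ↦ if p = (i.castSucc, i.succ) then p else
      (swap i.castSucc i.succ p.1, swap i.castSucc i.succ p.2))
    (fun p ↦ if p = (i.castSucc, i.succ) then p else
      (swap i.castSucc i.succ p.1, swap i.castSucc i.succ p.2)) ?_ ?_ ?_ ?_
  · rintro ⟨a, b⟩ hab
    simp only [Finset.mem_coe, Finset.mem_insert, Finset.mem_filter, Finset.mem_univ,
      true_and] at hab ⊢
    simp only [Perm.mul_apply] at hab ⊢
    split_ifs with h'
    · exact Or.inl h'
    · exact Or.inr ⟨hlt hab.1 h', hab.2⟩
  · rintro ⟨a, b⟩ hab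
    simp only [Finset.mem_coe, Finset.mem_insert, Finset.mem_filter, Finset.mem_univ,
      true_and] at hab ⊢
    simp only [Perm.mul_apply] at hab ⊢
    split_ifs with h'
    · obtain ⟨rfl, rfl⟩ := Prod.mk.inj h'
      simp [h]
    · have := hab.resolve_left h'
      exact ⟨hlt this.1 h', by simpa using this.2⟩
  all_goals
    rintro ⟨a, b⟩ hab
    simp only [Finset.mem_coe, Finset.mem_insert, Finset.mem_filter, Finset.mem_univ, true_and] at hab
    by_cases h' : (a, b) = (i.castSucc, i.succ)
    · simp [h']
    -- Only the reversed pair could be carried to the exceptional pair, and it is excluded by `a <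
    -- b`.
    · have h2 : (swap i.castSucc i.succ a, swap i.castSucc i.succ b) ≠ (i.castSucc, i.succ) := by
        intro h3
        obtain ⟨h4, h5⟩ := Prod.mk.inj h3
        have h6 : a < b := by tauto
        rw [swap_apply_eq_iff, swap_apply_left] at h4
        rw [swap_apply_eq_iff, swap_apply_right] at h5
        rw [h4, h5] at h6
        exact absurd h6 (by simp [Fin.le_def])
      simp [h', h2]

theorem inversionCount_mul_swap_add_one (σ : Perm (Fin (n + 1))) (i : Fin n)
    (h : σ i.succ < σ i.castSucc) :
    inversionCount (σ * swap i.castSucc i.succ) + 1 = inversionCount σ := by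
  rw [← inversionCount_mul_swap _ i (by simpa using h), mul_assoc, swap_mul_self, mul_one]

theorem eq_one_of_forall_castSucc_lt_succ (σ : Perm (Fin (n + 1)))
    (h : ∀ i : Fin n, σ i.castSucc < σ i.succ) : σ = 1 := by
  have hm : StrictMono σ := Fin.strictMono_iff_lt_succ.2 h
  have := Subsingleton.elim (hm.orderIsoOfSurjective _ σ.surjective) (OrderIso.refl _)
  ext x
  exact congrArg Fin.val (DFunLike.congr_fun this x)

/-- Upper bound: a nonidentity permutation has a descent, and removing it lowers the inversion
number by one. Lower bound: each letter of a reduced word adds at most one inversion. -/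
theorem length_eq_inversionCount (w : W) : cs.length w = inversionCount (permEquiv cs w) := by
  apply le_antisymm
  · induction hk : inversionCount (permEquiv cs w) generalizing w with
    | zero =>
      suffices w = 1 by simp [this]
      refine (permEquiv cs).injective ?_
      rw [map_one]
      refine eq_one_of_forall_castSucc_lt_succ _ fun i ↦ ?_
      by_contra! hi
      have := inversionCount_mul_swap_add_one (permEquiv cs w) i
        (lt_of_le_of_ne hi (by simp [Fin.ext_iff]))
      omega
    | succ k ih =>
      have : ∃ i : Fin n, permEquiv cs w i.succ < permEquiv cs w i.castSucc := by
        by_contra! hi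
        have h1 := eq_one_of_forall_castSucc_lt_succ (permEquiv cs w)
          fun i ↦ lt_of_le_of_ne (hi i) (by simp [Fin.ext_iff])
        rw [h1, inversionCount_one] at hk
        omega
      obtain ⟨i, hi⟩ := this
      have h1 := inversionCount_mul_swap_add_one (permEquiv cs w) i hi
      have h2 := ih (w * cs.simple i) (by rw [map_mul, permEquiv_simple]; omega)
      have h3 := cs.length_mul_simple w i
      omega
  · obtain ⟨ω, hω, rfl⟩ := cs.exists_isReduced w
    rw [hω.eq]
    clear hω
    induction ω using List.reverseRecOn with
    | nil =>
      simp [inversionCount_one]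
    | append_singleton ω i ih =>
      rw [cs.wordProd_append, cs.wordProd_singleton, map_mul, permEquiv_simple,
        List.length_append, List.length_singleton]
      rcases lt_or_gt_of_ne (show permEquiv cs (cs.wordProd ω) i.castSucc ≠
        permEquiv cs (cs.wordProd ω) i.succ by simp [Fin.ext_iff]) with h | h
      · rw [inversionCount_mul_swap _ i h]; omega
      · have := inversionCount_mul_swap_add_one _ i h; omega

theorem length_lt_length_mul_simple_iff (w : W) (i : Fin n) :
    cs.length w < cs.length (w * cs.simple i) ↔
      permEquiv cs w i.castSucc < permEquiv cs w i.succ := by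
  rw [length_eq_inversionCount, length_eq_inversionCount, map_mul, permEquiv_simple]
  rcases lt_or_gt_of_ne (show permEquiv cs w i.castSucc ≠ permEquiv cs w i.succ by
    simp [Fin.ext_iff]) with h | h
  · simp [inversionCount_mul_swap _ i h, h]
  · simp only [← inversionCount_mul_swap_add_one _ i h, h.not_gt]; simp

theorem mem_transversal_leftConnected_iff (w : W) (m : ℕ) :
    w ∈ transversal cs (leftConnected n m) ↔
      StrictMonoOn (permEquiv cs w) {a : Fin (n + 1) | (a : ℕ) ≤ m} := by
  simp only [transversal, leftConnected, Set.mem_ofPred_eq, length_lt_length_mul_simple_iff]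
  constructor
  · intro h a _ b hb hab
    have key (d : ℕ) (a b : Fin (n + 1)) (hb : (b : ℕ) ≤ m) (hd : (a : ℕ) + d + 1 = b) :
        permEquiv cs w a < permEquiv cs w b := by
      induction d generalizing b with
      | zero =>
        have h1 : b = Fin.succ ⟨a, by omega⟩ := by ext; simp; omega
        rw [h1]
        exact h ⟨a, by omega⟩ (by simp only; omega)
      | succ d ih =>
        refine (ih ⟨a + d + 1, by omega⟩ (by simp only; omega) rfl).trans ?_
        have := h ⟨a + d + 1, by omega⟩ (by simp only; omega)
        have hb' : b = Fin.succ ⟨a + d + 1, by omega⟩ := by ext; simp; omega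
        exact this.trans_eq (congrArg _ hb'.symm)
    exact key (b - a - 1) a b hb (by have : (a : ℕ) < b := hab; omega)
  · intro h i hi
    exact h (by simp; omega) (by simp; omega) (by simp [Fin.lt_def])

end PermutationRepresentation

/-! ### Multiplication by `x_{n-1}` as reinsertion of the last letter -/

section Multiplication

open Equiv

variable {n : ℕ}

/-- The permutation which moves the last point to `i` and is increasing on the other points. -/
def insertLast (i : Fin (n + 1)) : Perm (Fin (n + 1)) :=
  (finSuccEquiv' (Fin.last n)).trans (finSuccEquiv' i).symm

@[simp]
theorem insertLast_last (i : Fin (n + 1)) : insertLast i (Fin.last n) = i := by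
  simp [insertLast]

@[simp]
theorem insertLast_castSucc (i : Fin (n + 1)) (a : Fin n) :
    insertLast i a.castSucc = i.succAbove a := by
  rw [← Fin.succAbove_last_apply]
  simp only [insertLast, trans_apply, finSuccEquiv'_succAbove, finSuccEquiv'_symm_some]

theorem insertLast_injective : Function.Injective (insertLast (n := n)) := fun i j h ↦ by
  simpa using congrArg (fun σ : Perm (Fin (n + 1)) ↦ σ (Fin.last n)) h

theorem strictMonoOn_insertLast (hn : 1 ≤ n) (i : Fin (n + 1)) :
    StrictMonoOn (insertLast i) {a : Fin (n + 1) | (a : ℕ) ≤ n - 1} := by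
  intro a ha b hb hab
  simp only [Set.mem_ofPred_eq] at ha hb
  obtain ⟨a, rfl⟩ := Fin.exists_castSucc_eq.2 (show a ≠ Fin.last n by
    simp [Fin.ext_iff]; omega)
  obtain ⟨b, rfl⟩ := Fin.exists_castSucc_eq.2 (show b ≠ Fin.last n by
    simp [Fin.ext_iff]; omega)
  simpa using hab

/-- An increasing enumeration is determined by its range, here the complement of the last value. -/
theorem eq_insertLast_of_strictMonoOn (hn : 1 ≤ n) (σ : Perm (Fin (n + 1)))
    (h : StrictMonoOn σ {a : Fin (n + 1) | (a : ℕ) ≤ n - 1}) :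
    insertLast (σ (Fin.last n)) = σ := by
  have h1 : StrictMono (σ ∘ Fin.castSucc) := fun a b hab ↦
    h (by simp only [Set.mem_ofPred_eq, Fin.val_castSucc]; omega)
      (by simp only [Set.mem_ofPred_eq, Fin.val_castSucc]; omega) hab
  have h2 : σ ∘ Fin.castSucc = (σ (Fin.last n)).succAbove := by
    refine (StrictMono.range_inj h1 (Fin.strictMono_succAbove _)).1 ?_
    rw [Fin.range_succAbove, Set.range_comp, Fin.range_castSucc]
    ext x
    simp only [Set.mem_image, Set.mem_ofPred_eq, Set.mem_compl_iff, Set.mem_singleton_iff]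
    constructor
    · rintro ⟨y, hy, rfl⟩ h3
      rw [σ.injective h3] at hy
      simp at hy
    · intro hx
      refine ⟨σ.symm x, ?_, by simp⟩
      by_contra h3
      refine hx ?_
      rw [← σ.symm_apply_eq]
      ext
      simp only [Fin.val_last]
      omega
  ext a
  induction a using Fin.lastCases with
  | last => simp
  | cast a => rw [insertLast_castSucc, ← h2, Function.comp_apply]

/-- Reinsertion beyond position `m` leaves the first `m + 1` letters untouched. -/
theorem strictMonoOn_mul_insertLast_inv_of_lt (σ : Perm (Fin (n + 1))) {m : ℕ} {i : Fin (n + 1)}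
    (hi : m < i) :
    StrictMonoOn (σ * (insertLast i)⁻¹ : Perm (Fin (n + 1))) {a : Fin (n + 1) | (a : ℕ) ≤ m} ↔
      StrictMonoOn σ {a : Fin (n + 1) | (a : ℕ) ≤ m} := by
  have : Set.EqOn (σ * (insertLast i)⁻¹ : Perm (Fin (n + 1))) σ {a : Fin (n + 1) | (a : ℕ) ≤ m} := by
    intro a ha
    simp only [Set.mem_ofPred_eq] at ha
    rw [Perm.mul_apply]
    congr 1
    rw [Perm.inv_eq_iff_eq]
    obtain ⟨a, rfl⟩ := Fin.exists_castSucc_eq.2 (show a ≠ Fin.last n by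
      simp [Fin.ext_iff]; omega)
    rw [insertLast_castSucc, Fin.succAbove_of_castSucc_lt]
    simp only [Fin.lt_def]
    omega
  exact this.congr_strictMonoOn

/-- The first `m + 1` letters are now the first `m` letters of `σ` with its last letter inserted at
`i`. They increase exactly when the old ones do and `i` separates the smaller letters from the
larger ones. -/
theorem strictMonoOn_mul_insertLast_inv_of_le (σ : Perm (Fin (n + 1))) {m : ℕ} {i : Fin (n + 1)}
    (hi : i ≤ m) (hm : m ≤ n) :
    StrictMonoOn (σ * (insertLast i)⁻¹ : Perm (Fin (n + 1))) {a : Fin (n + 1) | (a : ℕ) ≤ m} ↔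
      StrictMonoOn σ {a : Fin (n + 1) | (a : ℕ) < m} ∧
        ∀ a : Fin n, (a : ℕ) < m → (a.castSucc < i ↔ σ a.castSucc < σ (Fin.last n)) := by
  set u := σ * (insertLast i)⁻¹ with hu
  have hσ : σ = u * insertLast i := by simp [hu]
  have h1 : σ (Fin.last n) = u i := by simp [hσ]
  have h2 (a : Fin n) : σ a.castSucc = u (i.succAbove a) := by simp [hσ]
  have h3 (a : Fin n) : (i.succAbove a : ℕ) ≤ m ↔ (a : ℕ) < m := by
    simp only [Fin.succAbove, Fin.lt_def]
    split_ifs with h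
    · simp only [Fin.val_castSucc] at *; omega
    · simp only [Fin.val_castSucc, Fin.val_succ] at *; omega
  constructor
  · intro h
    refine ⟨fun a ha b hb hab ↦ ?_, fun a ha ↦ ?_⟩
    · simp only [Set.mem_ofPred_eq] at ha hb
      obtain ⟨a, rfl⟩ := Fin.exists_castSucc_eq.2 (show a ≠ Fin.last n by
        simp [Fin.ext_iff]; omega)
      obtain ⟨b, rfl⟩ := Fin.exists_castSucc_eq.2 (show b ≠ Fin.last n by
        simp [Fin.ext_iff]; omega)
      rw [h2, h2]
      exact h ((h3 a).2 ha) ((h3 b).2 hb) (Fin.succAbove_lt_succAbove_iff.2 hab)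
    · rw [h1, h2, h.lt_iff_lt ((h3 a).2 ha) hi, Fin.succAbove_lt_iff_castSucc_lt]
  · rintro ⟨h, h'⟩ p hp q hq hpq
    rcases Fin.eq_self_or_eq_succAbove i p with rfl | ⟨a, rfl⟩
    · obtain ⟨b, rfl⟩ := Fin.exists_succAbove_eq hpq.ne'
      rw [← h1, ← h2]
      refine lt_of_le_of_ne ?_ ((σ.injective.ne (Fin.castSucc_lt_last b).ne'))
      rw [← not_lt, ← h' b ((h3 b).1 hq), not_lt]
      rwa [Fin.lt_succAbove_iff_le_castSucc] at hpq
    · rcases Fin.eq_self_or_eq_succAbove i q with rfl | ⟨b, rfl⟩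
      · rw [← h1, ← h2, ← h' a ((h3 a).1 hp)]
        rwa [Fin.succAbove_lt_iff_castSucc_lt] at hpq
      · rw [← h2, ← h2]
        exact h ((h3 a).1 hp) ((h3 b).1 hq)
          (Fin.castSucc_lt_castSucc_iff.2 (Fin.succAbove_lt_succAbove_iff.1 hpq))

theorem existsUnique_insertion_position (σ : Perm (Fin (n + 1))) {m : ℕ} (hm : m ≤ n)
    (h : StrictMonoOn σ {a : Fin (n + 1) | (a : ℕ) < m}) :
    ∃! i : Fin (n + 1), (i : ℕ) ≤ m ∧
      ∀ a : Fin n, (a : ℕ) < m → (a.castSucc < i ↔ σ a.castSucc < σ (Fin.last n)) := by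
  classical
  -- The position sought is that of the first letter exceeding the last one; the alternative `m ≤ k`
  -- caps it at `m` when there is none before.
  have hex : ∃ k : ℕ, m ≤ k ∨ ∃ hk : k < n, σ (Fin.last n) < σ (Fin.castSucc ⟨k, hk⟩) :=
    ⟨m, Or.inl le_rfl⟩
  have hle : Nat.find hex ≤ m := Nat.find_min' hex (Or.inl le_rfl)
  have hi' : ∀ a : Fin n, (a : ℕ) < m →
      ((a : ℕ) < Nat.find hex ↔ σ a.castSucc < σ (Fin.last n)) := by
    intro a ha
    constructor
    · intro hlt
      have := Nat.find_min hex hlt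
      push Not at this
      exact lt_of_le_of_ne (this.2 a.2) (σ.injective.ne (Fin.castSucc_lt_last a).ne)
    · intro hlt
      by_contra! hge
      rcases Nat.find_spec hex with h1 | ⟨hk, h1⟩
      · omega
      · refine (h1.trans_le ?_).not_gt hlt
        exact h.monotoneOn (show Nat.find hex < m by omega) ha hge
  refine ⟨⟨Nat.find hex, by omega⟩, ⟨hle, hi'⟩, ?_⟩
  rintro j ⟨hj, hj'⟩
  ext
  simp only
  by_contra hne
  rcases lt_or_gt_of_ne hne with hlt | hlt
  · have h1 := (hj' ⟨j, by omega⟩ (by simp only; omega)).trans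
      (hi' ⟨j, by omega⟩ (by simp only; omega)).symm
    simp only [Fin.lt_def, Fin.val_castSucc] at h1
    omega
  · have h1 := (hj' ⟨Nat.find hex, by omega⟩ (by simp only; omega)).trans
      (hi' ⟨Nat.find hex, by omega⟩ (by simp only; omega)).symm
    simp only [Fin.lt_def, Fin.val_castSucc] at h1
    omega

open scoped Classical in
theorem card_strictMonoOn_mul_insertLast_inv (σ : Perm (Fin (n + 1))) {m : ℕ} (hm : m ≤ n) :
    Finset.card {i : Fin (n + 1) | StrictMonoOn (σ * (insertLast i)⁻¹ : Perm (Fin (n + 1)))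
      {a : Fin (n + 1) | (a : ℕ) ≤ m}} =
    (if StrictMonoOn σ {a : Fin (n + 1) | (a : ℕ) ≤ m - 1} then 1 else 0) +
      (n - m) * if StrictMonoOn σ {a : Fin (n + 1) | (a : ℕ) ≤ m} then 1 else 0 := by
  -- At `m = 0` the truncated `m - 1` gives a one-point set instead of the empty set; monotonicity
  -- is vacuous on both.
  have hset : StrictMonoOn σ {a : Fin (n + 1) | (a : ℕ) ≤ m - 1} ↔
      StrictMonoOn σ {a : Fin (n + 1) | (a : ℕ) < m} := by
    rcases Nat.eq_zero_or_pos m with rfl | hm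
    · refine iff_of_true (fun a ha b hb hab ↦ ?_) (fun a ha ↦ by simp at ha)
      simp only [Set.mem_ofPred_eq] at ha hb
      have : (a : ℕ) < b := hab
      omega
    · simp only [Nat.le_sub_one_iff_lt hm]
  simp only [hset]
  rw [← Finset.card_filter_add_card_filter_not (fun i : Fin (n + 1) ↦ (i : ℕ) ≤ m)]
  congr 1
  · rw [Finset.filter_filter]
    split_ifs with h
    · obtain ⟨i, ⟨hi, hi'⟩, huniq⟩ := existsUnique_insertion_position σ hm h
      rw [Finset.card_eq_one]
      refine ⟨i, ?_⟩
      ext j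
      simp only [Finset.mem_filter, Finset.mem_univ, true_and, Finset.mem_singleton]
      constructor
      · rintro ⟨h1, h2⟩
        exact huniq j ⟨h2, ((strictMonoOn_mul_insertLast_inv_of_le σ h2 hm).1 h1).2⟩
      · rintro rfl
        exact ⟨(strictMonoOn_mul_insertLast_inv_of_le σ hi hm).2 ⟨h, hi'⟩, hi⟩
    · rw [Finset.card_eq_zero, Finset.filter_eq_empty_iff]
      rintro i - ⟨h1, h2⟩
      exact h ((strictMonoOn_mul_insertLast_inv_of_le σ h2 hm).1 h1).1
  · have hcard : Finset.card {i : Fin (n + 1) | ¬ (i : ℕ) ≤ m} = n - m := by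
      have : ({i : Fin (n + 1) | ¬ (i : ℕ) ≤ m} : Finset (Fin (n + 1))) =
          Finset.Ioi ⟨m, by omega⟩ := by
        ext i; simp [Fin.lt_def]
      rw [this, Fin.card_Ioi]
      simp
    rw [Finset.filter_filter]
    split_ifs with h
    · rw [mul_one, ← hcard]
      congr 1
      ext i
      simp only [Finset.mem_filter, Finset.mem_univ, true_and, and_iff_right_iff_imp]
      exact fun hi ↦ (strictMonoOn_mul_insertLast_inv_of_lt σ (not_le.1 hi)).2 h
    · rw [mul_zero, Finset.card_eq_zero, Finset.filter_eq_empty_iff]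
      rintro i - ⟨h1, h2⟩
      exact h ((strictMonoOn_mul_insertLast_inv_of_lt σ (not_le.1 h2)).1 h1)

variable {W : Type*} [Group W] [Fintype W] (cs : CoxeterSystem (CoxeterMatrix.A n) W)

open scoped Classical in
theorem coeff_xA (m : ℕ) (w : W) :
    (xA cs m).coeff w =
      if StrictMonoOn (permEquiv cs w) {a : Fin (n + 1) | (a : ℕ) ≤ m} then 1 else 0 := by
  simp [xA, xElt, ← mem_transversal_leftConnected_iff, MonoidAlgebra.coeff_sum,
    Finsupp.finsetSum_apply, Finsupp.single_apply]

theorem xA_pred_eq_sum (hn : 1 ≤ n) :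
    xA cs (n - 1) =
      ∑ i : Fin (n + 1), MonoidAlgebra.of ℚ W ((permEquiv cs).symm (insertLast i)) := by
  classical
  rw [xA, xElt]
  symm
  refine Finset.sum_bij (fun i _ ↦ (permEquiv cs).symm (insertLast i)) ?_ ?_ ?_ ?_
  · intro i _
    simp only [Finset.mem_filter, Finset.mem_univ, true_and, mem_transversal_leftConnected_iff,
      MulEquiv.apply_symm_apply]
    exact strictMonoOn_insertLast hn i
  · intro i _ j _ h
    exact insertLast_injective ((permEquiv cs).symm.injective h)
  · intro w hw
    simp only [Finset.mem_filter, Finset.mem_univ, true_and,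
      mem_transversal_leftConnected_iff] at hw
    exact ⟨permEquiv cs w (Fin.last n), Finset.mem_univ _,
      by rw [eq_insertLast_of_strictMonoOn hn _ hw, MulEquiv.symm_apply_apply]⟩
  · intros; rfl

/-- The coefficient at `w` counts reinsertions: one good position up to `m` if the first `m` letters
increase, and all `n - m` later positions if the first `m + 1` do. At `m = 0` truncation makes this
`x_0 x_{n-1} = (n + 1) x_0`. -/
theorem xA_mul_xA_pred (hn : 1 ≤ n) {m : ℕ} (hm : m ≤ n) :
    xA cs m * xA cs (n - 1) = xA cs (m - 1) + (n - m : ℕ) • xA cs m := by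
  classical
  ext w
  have h := congrArg (Nat.cast : ℕ → ℚ)
    (card_strictMonoOn_mul_insertLast_inv (permEquiv cs w) hm)
  simp only [Nat.cast_add, Nat.cast_mul, Nat.cast_ite, Nat.cast_one, Nat.cast_zero] at h
  rw [xA_pred_eq_sum cs hn, Finset.mul_sum]
  simp only [MonoidAlgebra.coeff_sum, Finsupp.finsetSum_apply, MonoidAlgebra.of_apply,
    MonoidAlgebra.coeff_mul_single_apply, mul_one, MonoidAlgebra.coeff_add,
    MonoidAlgebra.coeff_smul, Finsupp.add_apply, Finsupp.smul_apply]
  simp only [coeff_xA, map_mul, map_inv, MulEquiv.apply_symm_apply, Finset.sum_boole, nsmul_eq_mul]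
  exact h

end Multiplication

/-! ### Powers and falling powers of a variable -/

section StirlingNumbers

open Polynomial

/-- The exponent `k + m` has the parity of `k - m` and makes sense for all `m`, which suits the
induction. -/
theorem coeff_descPochhammer (k m : ℕ) :
    (descPochhammer ℚ k).coeff m = (-1) ^ (k + m) * (Nat.stirlingFirst k m : ℚ) := by
  induction k generalizing m with
  | zero => cases m <;> simp [Polynomial.coeff_one]
  | succ k ih =>
    rw [descPochhammer_succ_right, mul_sub, coeff_sub, coeff_mul_natCast]
    cases m with
    | zero => cases k <;> simp [ih]
    | succ m =>
      rw [coeff_mul_X, ih, ih, Nat.stirlingFirst_succ_succ]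
      push_cast
      ring

theorem descPochhammer_eq_sum_stirlingFirst (k : ℕ) :
    descPochhammer ℚ k = ∑ m ∈ Finset.range (k + 1),
      ((-1 : ℚ) ^ (k - m) * (Nat.stirlingFirst k m : ℚ)) • (X : ℚ[X]) ^ m := by
  rw [(descPochhammer ℚ k).as_sum_range, descPochhammer_natDegree]
  refine Finset.sum_congr rfl fun m hm ↦ ?_
  have hm : m ≤ k := by simpa [Nat.lt_succ_iff] using hm
  rw [coeff_descPochhammer, ← smul_X_eq_monomial]
  obtain ⟨d, rfl⟩ := Nat.exists_eq_add_of_le hm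
  rw [Nat.add_sub_cancel_left, show m + d + m = d + 2 * m by ring, pow_add, pow_mul]
  simp

theorem X_pow_eq_sum_stirlingSecond (k : ℕ) :
    (X : ℚ[X]) ^ k = ∑ m ∈ Finset.range (k + 1),
      (Nat.stirlingSecond k m : ℚ) • descPochhammer ℚ m := by
  induction k with
  | zero => simp
  | succ k ih =>
    have hX (m : ℕ) : descPochhammer ℚ m * X =
        descPochhammer ℚ (m + 1) + (m : ℚ) • descPochhammer ℚ m := by
      rw [descPochhammer_succ_right, smul_eq_C_mul]
      simp
      ring
    rw [pow_succ, ih, Finset.sum_mul, Finset.sum_range_succ' _ (k + 1)]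
    simp only [smul_mul_assoc, hX, Nat.stirlingSecond_succ_succ, smul_add, Finset.sum_add_distrib,
      Nat.cast_add, Nat.cast_mul, Nat.cast_one, add_smul, smul_smul,
      Nat.stirlingSecond_succ_zero]
    -- The two sums differ by an index shift: the top term of one vanishes because its Stirling
    -- number does, the bottom term of the other because of the factor `m = 0`.
    rw [Finset.sum_range_succ (fun m ↦ (((m : ℚ) + 1) * (Nat.stirlingSecond k (m + 1) : ℚ)) •
      descPochhammer ℚ (m + 1)) k, Nat.stirlingSecond_eq_zero_of_lt (Nat.lt_succ_self k),
      Finset.sum_range_succ' (fun m ↦ ((Nat.stirlingSecond k m : ℚ) * (m : ℚ)) •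
        descPochhammer ℚ m) k]
    simp [mul_comm, add_comm]

end StirlingNumbers

/-! ### Bases and presentation of the algebra -/

section Structure

open Polynomial

variable {n : ℕ} {W : Type*} [Group W] [Fintype W] (cs : CoxeterSystem (CoxeterMatrix.A n) W)

theorem xA_self : xA cs n = 1 := by
  classical
  ext w
  rw [coeff_xA, MonoidAlgebra.one_def, MonoidAlgebra.coeff_single, Finsupp.single_apply]
  congr 1
  rw [eq_iff_iff]
  constructor
  · intro h
    refine (permEquiv cs).injective (Eq.symm ?_)
    rw [map_one]
    exact eq_one_of_forall_castSucc_lt_succ _ fun i ↦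
      h (by simp) (by simp) (by simp [Fin.lt_def])
  · rintro rfl
    rw [map_one]
    exact strictMono_id.strictMonoOn _

/-- The recurrence reads `x_{n-k} (x_{n-1} - k) = x_{n-k-1}`. The range goes one past `n` on
purpose: for `k = n` and `k = n + 1` the left side is `x_0`, which yields the defining relation. -/
theorem xA_sub_eq_aeval (hn : 1 ≤ n) {k : ℕ} (hk : k ≤ n + 1) :
    xA cs (n - k) = aeval (xA cs (n - 1)) (descPochhammer ℚ k) := by
  induction k with
  | zero => simp [xA_self]
  | succ k ih =>
    have h := xA_mul_xA_pred cs hn (Nat.sub_le n k)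
    rw [Nat.sub_sub_self (by omega), Nat.sub_sub] at h
    rw [descPochhammer_succ_right, map_mul, ← ih (by omega), map_sub, aeval_X, map_natCast,
      mul_sub, h, nsmul_eq_mul, Nat.cast_comm, add_sub_cancel_right]

/-- The coefficients of the `x_j` at suitable group elements form a unitriangular matrix. -/
theorem linearIndependent_xA :
    LinearIndependent ℚ fun j : Fin (n + 1) ↦ xA cs j := by
  classical
  rw [Fintype.linearIndependent_iff]
  intro c hc
  have key (i : Fin (n + 1)) : ∑ j : Fin (n + 1), c j * (if j ≤ i then 1 else 0) = 0 := by
    -- For `i < n` the generator with index `i` serves, as its only descent is between positions `i`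
    -- and `i + 1`; for `i = n` the identity does.
    obtain ⟨w, hw⟩ : ∃ w : W, ∀ j : Fin (n + 1),
        StrictMonoOn (permEquiv cs w) {a : Fin (n + 1) | (a : ℕ) ≤ j} ↔ j ≤ i := by
      induction i using Fin.lastCases with
      | last =>
        refine ⟨1, fun j ↦ iff_of_true ?_ (Fin.le_last j)⟩
        rw [map_one]
        exact strictMono_id.strictMonoOn _
      | cast i =>
        refine ⟨cs.simple i, fun j ↦ ?_⟩
        rw [permEquiv_simple]
        constructor
        · intro h
          by_contra! hlt
          simp only [Fin.lt_def, Fin.val_castSucc] at hlt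
          have := @h i.castSucc (by simp only [Set.mem_ofPred_eq, Fin.val_castSucc]; omega)
            i.succ (by simp only [Set.mem_ofPred_eq, Fin.val_succ]; omega) (by simp [Fin.lt_def])
          rw [Equiv.swap_apply_left, Equiv.swap_apply_right] at this
          simp [Fin.lt_def] at this
        · intro hj a ha b hb hab
          simp only [Set.mem_ofPred_eq, Fin.le_def, Fin.lt_def, Fin.val_castSucc] at ha hb hab hj
          rw [Equiv.swap_apply_of_ne_of_ne (a := i.castSucc) (x := a)
            (by simp [Fin.ext_iff]; omega) (by simp [Fin.ext_iff]; omega), Equiv.swap_apply_def]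
          simp only [Fin.lt_def, Fin.ext_iff]
          split_ifs <;> simp at * <;> omega
    have h := congrArg (fun x : MonoidAlgebra ℚ W ↦ x.coeff w) hc
    simp only [MonoidAlgebra.coeff_sum, Finsupp.finsetSum_apply, MonoidAlgebra.coeff_smul,
      Finsupp.smul_apply, coeff_xA, hw, smul_eq_mul, MonoidAlgebra.coeff_zero,
      Finsupp.zero_apply] at h
    exact h
  intro i
  induction i using WellFoundedLT.induction with
  | ind i ih =>
    rw [← key i, Finset.sum_eq_single i]
    · simp
    · intro j _ hj
      rcases lt_or_gt_of_ne hj with h | h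
      · simp [ih j h]
      · simp [h.not_ge]
    · simp

theorem xA_sub_eq_sum (hn : 1 ≤ n) {k : ℕ} (hk : k ≤ n) :
    xA cs (n - k) = ∑ m ∈ Finset.range (k + 1),
      ((-1 : ℚ) ^ (k - m) * (Nat.stirlingFirst k m : ℚ)) • xA cs (n - 1) ^ m := by
  rw [xA_sub_eq_aeval cs hn (by omega), descPochhammer_eq_sum_stirlingFirst]
  simp

theorem xA_pred_pow_eq_sum (hn : 1 ≤ n) {k : ℕ} (hk : k ≤ n) :
    xA cs (n - 1) ^ k = ∑ m ∈ Finset.range (k + 1),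
      (Nat.stirlingSecond k m : ℚ) • xA cs (n - m) := by
  have h := congrArg (aeval (xA cs (n - 1))) (X_pow_eq_sum_stirlingSecond k)
  rw [map_pow, aeval_X, map_sum] at h
  rw [h]
  refine Finset.sum_congr rfl fun m hm ↦ ?_
  rw [Finset.mem_range] at hm
  rw [map_smul, xA_sub_eq_aeval cs hn (k := m) (by omega)]

theorem aeval_fallingRelation (hn : 1 ≤ n) :
    aeval (xA cs (n - 1)) (descPochhammer ℚ (n + 1) - descPochhammer ℚ n) = 0 := by
  rw [map_sub, ← xA_sub_eq_aeval cs hn le_rfl, ← xA_sub_eq_aeval cs hn (Nat.le_succ n),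
    Nat.sub_self, Nat.sub_eq_zero_of_le (Nat.le_succ n), sub_self]

theorem monic_fallingRelation (n : ℕ) :
    (descPochhammer ℚ (n + 1) - descPochhammer ℚ n).Monic := by
  refine (monic_descPochhammer ℚ _).sub_of_left ?_
  refine degree_lt_degree ?_
  simp [descPochhammer_natDegree]

theorem degree_fallingRelation (n : ℕ) :
    (descPochhammer ℚ (n + 1) - descPochhammer ℚ n).degree = (n + 1 : ℕ) := by
  have h : (descPochhammer ℚ n).degree < (descPochhammer ℚ (n + 1)).degree :=
    degree_lt_degree (by simp [descPochhammer_natDegree])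
  rw [degree_sub_eq_left_of_degree_lt h,
    degree_eq_natDegree (monic_descPochhammer ℚ _).ne_zero, descPochhammer_natDegree]

/-- The remainder of `p` modulo the polynomial generating `fallingIdeal n` takes the same value at
`x_{n-1}` as `p`, and this value is a linear combination of the first `n + 1` powers. -/
theorem aeval_eq_sum_modByMonic (hn : 1 ≤ n) (p : ℚ[X]) :
    aeval (xA cs (n - 1)) p = ∑ i : Fin (n + 1),
      (p %ₘ (descPochhammer ℚ (n + 1) - descPochhammer ℚ n)).coeff i •
        xA cs (n - 1) ^ (i : ℕ) := by
  rw [← aeval_modByMonic_eq_self_of_root (aeval_fallingRelation cs hn), aeval_eq_sum_range',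
    Finset.sum_range]
  have hd := natDegree_eq_of_degree_eq_some (degree_fallingRelation n)
  refine (natDegree_modByMonic_lt p (monic_fallingRelation n) fun h ↦ ?_).trans_eq hd
  rw [h, natDegree_one] at hd
  omega

theorem mem_algA_iff (y : MonoidAlgebra ℚ W) :
    y ∈ algA cs ↔ ∃ p : ℚ[X], aeval (xA cs (n - 1)) p = y := by
  change y ∈ Algebra.adjoin ℚ {xA cs (n - 1)} ↔ _
  rw [Algebra.adjoin_singleton_eq_range_aeval]
  rfl

theorem xA_mem (hn : 1 ≤ n) (j : Fin (n + 1)) : xA cs j ∈ algA cs := by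
  rw [mem_algA_iff]
  refine ⟨_, (xA_sub_eq_aeval cs hn (k := n - j) (by omega)).symm.trans ?_⟩
  rw [Nat.sub_sub_self (by omega)]

theorem xA_pred_pow_mem (i : ℕ) : xA cs (n - 1) ^ i ∈ algA cs :=
  pow_mem (xA_mem_algA cs) i

theorem xA_pred_pow_mem_span (hn : 1 ≤ n) (i : Fin (n + 1)) :
    xA cs (n - 1) ^ (i : ℕ) ∈ Submodule.span ℚ (Set.range fun j : Fin (n + 1) ↦ xA cs j) := by
  rw [xA_pred_pow_eq_sum cs hn (by omega)]
  exact Submodule.sum_mem _ fun m _ ↦ Submodule.smul_mem _ _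
    (Submodule.subset_span ⟨⟨n - m, by omega⟩, rfl⟩)

theorem algA_le_span_pow (hn : 1 ≤ n) : Subalgebra.toSubmodule (algA cs) ≤
    Submodule.span ℚ (Set.range fun i : Fin (n + 1) ↦ xA cs (n - 1) ^ (i : ℕ)) := by
  intro y hy
  obtain ⟨p, rfl⟩ := (mem_algA_iff cs y).1 hy
  rw [aeval_eq_sum_modByMonic cs hn]
  exact Submodule.sum_mem _ fun i _ ↦ Submodule.smul_mem _ _ (Submodule.subset_span ⟨i, rfl⟩)

omit [Fintype W] in
theorem span_eq_top_of_le {ι : Type*} {A : Subalgebra ℚ (MonoidAlgebra ℚ W)} {v : ι → A}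
    (h : Subalgebra.toSubmodule A ≤ Submodule.span ℚ (Set.range fun i ↦ (v i : MonoidAlgebra ℚ W))) :
    ⊤ ≤ Submodule.span ℚ (Set.range v) := by
  intro y _
  have hy := h y.2
  rw [show (Set.range fun i ↦ (v i : MonoidAlgebra ℚ W)) = A.val.toLinearMap '' Set.range v by
    rw [← Set.range_comp]; rfl, Submodule.span_image] at hy
  obtain ⟨z, hz, hzy⟩ := hy
  rwa [← Subtype.ext (show (z : MonoidAlgebra ℚ W) = y from hzy)]

/-- The basis `x_0, …, x_n` of the algebra `ℚ[x_{n-1}]`. -/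
def xBasis (hn : 1 ≤ n) : Module.Basis (Fin (n + 1)) ℚ (algA cs) :=
  Module.Basis.mk (v := fun j ↦ (⟨xA cs j, xA_mem cs hn j⟩ : algA cs))
    (LinearIndependent.of_comp (algA cs).val.toLinearMap (linearIndependent_xA cs))
    (span_eq_top_of_le ((algA_le_span_pow cs hn).trans (Submodule.span_le.2 (by
      rintro _ ⟨i, rfl⟩
      exact xA_pred_pow_mem_span cs hn i))))

/-- The basis `x_{n-1}^0, …, x_{n-1}^n` of the algebra `ℚ[x_{n-1}]`. -/
def powBasis (hn : 1 ≤ n) : Module.Basis (Fin (n + 1)) ℚ (algA cs) :=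
  -- The powers span, and there are as many of them as elements of `xBasis`.
  basisOfTopLeSpanOfCardEqFinrank
    (fun i : Fin (n + 1) ↦ (⟨xA cs (n - 1) ^ (i : ℕ), xA_pred_pow_mem cs i⟩ : algA cs))
    (span_eq_top_of_le (algA_le_span_pow cs hn))
    (Module.finrank_eq_card_basis (xBasis cs hn)).symm

theorem coe_xBasis (hn : 1 ≤ n) (j : Fin (n + 1)) :
    (xBasis cs hn j : MonoidAlgebra ℚ W) = xA cs j := by
  simp [xBasis]

theorem coe_powBasis (hn : 1 ≤ n) (j : Fin (n + 1)) :
    (powBasis cs hn j : MonoidAlgebra ℚ W) = xA cs (n - 1) ^ (j : ℕ) := by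
  simp [powBasis]

/-- Evaluation of polynomials at `x_{n-1}`. -/
def evalHom : ℚ[X] →ₐ[ℚ] algA cs := aeval ⟨xA cs (n - 1), xA_mem_algA cs⟩

theorem coe_evalHom (p : ℚ[X]) :
    (evalHom cs p : MonoidAlgebra ℚ W) = aeval (xA cs (n - 1)) p := by
  exact (aeval_algHom_apply (algA cs).val ⟨xA cs (n - 1), xA_mem_algA cs⟩ p).symm

theorem evalHom_surjective : Function.Surjective (evalHom cs) := fun y ↦ by
  obtain ⟨p, hp⟩ := (mem_algA_iff cs y).1 y.2
  exact ⟨p, Subtype.ext ((coe_evalHom cs p).trans hp)⟩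

/-- If `p` vanishes at `x_{n-1}`, so does its remainder modulo the monic relation of degree `n + 1`.
Independence of the powers up to `n` makes that remainder zero. -/
theorem ker_evalHom (hn : 1 ≤ n) : RingHom.ker (evalHom cs) = fallingIdeal n := by
  apply le_antisymm
  · intro p hp
    rw [fallingIdeal, Ideal.mem_span_singleton,
      ← modByMonic_eq_zero_iff_dvd (monic_fallingRelation n)]
    have h0 : aeval (xA cs (n - 1)) p = 0 := by
      rw [← coe_evalHom, (RingHom.mem_ker).1 hp]; rfl
    rw [aeval_eq_sum_modByMonic cs hn] at h0
    have hli := (powBasis cs hn).linearIndependent.map' (algA cs).val.toLinearMap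
      (LinearMap.ker_eq_bot.2 Subtype.val_injective)
    have hc := Fintype.linearIndependent_iff.1 hli _ (by simpa [coe_powBasis] using h0)
    ext i
    rw [coeff_zero]
    by_cases hi : i < n + 1
    · exact hc ⟨i, hi⟩
    · refine coeff_eq_zero_of_degree_lt ((degree_modByMonic_lt p (monic_fallingRelation n)).trans_le
        ?_)
      rw [degree_fallingRelation]
      exact_mod_cast not_lt.1 hi
  · rw [fallingIdeal, Ideal.span_singleton_le_iff_mem, RingHom.mem_ker]
    exact Subtype.ext ((coe_evalHom cs _).trans (aeval_fallingRelation cs hn))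

/-- The algebra `ℚ[x_{n-1}]` is the quotient of `ℚ[x]` by `fallingIdeal n`. -/
def quotientEquiv (hn : 1 ≤ n) : (ℚ[X] ⧸ fallingIdeal n) ≃ₐ[ℚ] algA cs :=
  (Ideal.quotientEquivAlgOfEq ℚ (ker_evalHom cs hn).symm).trans
    (Ideal.quotientKerAlgEquivOfSurjective (evalHom_surjective cs))

theorem quotientEquiv_mk_X (hn : 1 ≤ n) :
    quotientEquiv cs hn (Ideal.Quotient.mk (fallingIdeal n) X) =
      ⟨xA cs (n - 1), xA_mem_algA cs⟩ := by
  change evalHom cs X = _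
  simp [evalHom]

end Structure

end CoxeterDescent

end

theorem mainTheorem4 (n : ℕ) (hn : 1 ≤ n) {W : Type*} [Group W] [Fintype W]
    (cs : CoxeterSystem (CoxeterMatrix.A n) W) :
    -- the isomorphism of `ℚ`-algebras, sending `x_{n-1}` to the class of `x`
    (∃ φ : CoxeterDescent.algA cs ≃ₐ[ℚ] (ℚ[X] ⧸ CoxeterDescent.fallingIdeal n),
      φ ⟨CoxeterDescent.xA cs (n - 1), CoxeterDescent.xA_mem_algA cs⟩ =
        Ideal.Quotient.mk (CoxeterDescent.fallingIdeal n) Polynomial.X) ∧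
    -- `x_{n-k}` is the `k`-th falling power of `x_{n-1}`
    (∀ k ≤ n, CoxeterDescent.xA cs (n - k) =
      Polynomial.aeval (CoxeterDescent.xA cs (n - 1)) (descPochhammer ℚ k)) ∧
    -- `x_0, …, x_n` is a basis
    (∃ b : Module.Basis (Fin (n + 1)) ℚ (CoxeterDescent.algA cs),
      ∀ j, (b j : MonoidAlgebra ℚ W) = CoxeterDescent.xA cs j) ∧
    -- the powers `x_{n-1}^0, …, x_{n-1}^n` are a basis
    (∃ p : Module.Basis (Fin (n + 1)) ℚ (CoxeterDescent.algA cs),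
      ∀ j, (p j : MonoidAlgebra ℚ W) = CoxeterDescent.xA cs (n - 1) ^ (j : ℕ)) ∧
    -- the base change formulas
    (∀ k ≤ n, CoxeterDescent.xA cs (n - k) =
      ∑ m ∈ Finset.range (k + 1),
        ((-1 : ℚ) ^ (k - m) * (Nat.stirlingFirst k m : ℚ)) •
          CoxeterDescent.xA cs (n - 1) ^ m) ∧
    (∀ k ≤ n, CoxeterDescent.xA cs (n - 1) ^ k =
      ∑ m ∈ Finset.range (k + 1),
        (Nat.stirlingSecond k m : ℚ) • CoxeterDescent.xA cs (n - m)) := by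
  open CoxeterDescent in
  exact ⟨⟨(quotientEquiv cs hn).symm, by
      rw [AlgEquiv.symm_apply_eq, quotientEquiv_mk_X]⟩,
    fun k hk ↦ xA_sub_eq_aeval cs hn (Nat.le_succ_of_le hk),
    ⟨xBasis cs hn, coe_xBasis cs hn⟩, ⟨powBasis cs hn, coe_powBasis cs hn⟩,
    fun k hk ↦ xA_sub_eq_sum cs hn hk, fun k hk ↦ xA_pred_pow_eq_sum cs hn hk⟩
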